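/- **Setting.** Let $V=\{1,\dots,m\}$ ($m\ge 1$) and let $G=(V,E)$ be a finite directed multigraph in which every vertex has at least one outgoing edge; $E^{i,j}$ is the set of edges from $i$ to $j$. Let $M$ be a complete smooth $n$-dimensional Riemannian manifold with its geodesic distance $d$, and suppose that $M$ is locally Euclidean (every point has an open neighbourhood isometric to an open subset of $\mathbb R^n$). Let $G$ be a GIFS of contractive similitudes on $M$ with domains $W_1,\dots,W_m\subseteq M$, nonempty compact sets: each $e\in E^{i,j}$ carries a map $f_e:W_j\to W_i$ with $d(f_e(x),f_e(y))=\rho_e\,d(x,y)$ for all $x,y\in W_j$, for some $0<\rho_e<1$ (so $\{W_i\}$ is an invariant family). For a directed path $\mathbf e=(e_1,\dots,e_q)$ from $i$ to $j$ put $|\mathbf e|=q$ and $f_{\mathbf e}=f_{e_1}\circ\cdots\circ f_{e_q}:W_j\to W_i$; $E^*$ is the set of directed paths of length $\ge 1$. *Nested index sets.* For directed paths write $\mathbf e\preceq\mathbf e'$ if $\mathbf e$ is an initial segment of $\mathbf e'$ or equals it. A sequence of nested index sets is a sequence $(\mathcal M_k)_{k\ge0}$, where $\mathcal M_0$ consists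 of the $m$ paths of length $0$ (the vertices), and each $\mathcal M_k$, $k\ge 1$, is a nonempty finite subset of $E^*$, such that, with $\underline m_k$ and $\overline m_k$ the minimal and maximal lengths of the elements of $\mathcal M_k$: (1) $(\underline m_k)$ and $(\overline m_k)$ are nondecreasing and tend to $\infty$; (2) for $k\ge1$ no element of $\mathcal M_k$ is a proper initial segment of another; (3) every $\mathbf e'\in E^*$ with $|\mathbf e'|>\overline m_k$ has an initial segment in $\mathcal M_k$; (4) every $\mathbf e'\in E^*$ with $|\mathbf e'|<\underline m_k$ is an initial segment of an element of $\mathcal M_k$; (5) there is $L\geq 1$, independent of $k$, with $|\mathbf e'|-|\mathbf e|\le L$ whenever $\mathbf e\in\mathcal M_k$, $\mathbf e'\in\mathcal M_{k+1}$, $\mathbf e\preceq\mathbf e'$. *Neighbourhood types.* Let $\mathbf U=\{U_i\}_{i=1}^m$ be an invariant family of nonempty bounded open sets: $U_i\subseteq W_i$ and $f_e(U_j)\subseteq U_i$ for all $e\in E^{i,j}$. Let $\mathcal V_k$ be the set of quadruples $(f_{\mathbf e},i,j,k)$ with $\mathbf e\in\mathcal M_k$ a path from $i$ to $j$ (for $k=0$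 these are $(\mathrm{id},i,i,0)$), and $\mathcal V=\bigcup_{k\ge0}\mathcal V_k$. For $\mathbf v=(f,i,j,k)\in\mathcal V$ write $f_{\mathbf v}=f$; its neighbourhood $\mathcal N(\mathbf v)$ is the set of $(h,i,j',k)\in\mathcal V_k$ with $f(U_j)\cap h(U_{j'})\ne\emptyset$. Vertices $\mathbf v=(f_{\mathbf v},i,j,k)$ and $\mathbf v'=(f_{\mathbf v'},i',j',k')$ are equivalent if $j=j'$ and $\tau=f_{\mathbf v'}\circ f_{\mathbf v}^{-1}$, extended to a similitude (all distances are multiplied by one positive constant) of the union of the sets $f_{\mathbf u}(W_{l})$, $\mathbf u=(f_{\mathbf u},i,l,k)\in\mathcal N(\mathbf v)$, into $M$, induces a bijection $$\mathcal N(\mathbf v)\to\mathcal N(\mathbf v'),\qquad \mathbf u=(f_{\mathbf u},i,l,k)\mapsto \mathbf u'=(\tau\circ f_{\mathbf u},i',l,k'),$$ such that, for all such $\mathbf u,\mathbf u'$, all $q\ge1$ and all vertices $t$, a path $\mathbf e\in E^*$ from $l$ to $t$ satisfies $(f_{\mathbf u}\circ f_{\mathbf e},i,t,k+q)\in\mathcal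 V_{k+q}$ if and only if it satisfies $(f_{\mathbf u'}\circ f_{\mathbf e},i',t,k'+q)\in\mathcal V_{k'+q}$. If, for some sequence of nested index sets, $\mathcal V$ has only finitely many equivalence classes, then $\mathbf U$ is called a finite type condition family of $G$; $G$ is of finite type if it has such a family. **Theorem 5.1.** Let $M$, $G$, $\{W_i\}$ be as above, and let $\mathbf U=\{U_i\}_{i=1}^m$ be an invariant family of nonempty bounded open sets with $\overline{U_i}=W_i$ for all $i$. Suppose that there are isometries (distance preserving bijections) $g_i:U_i\to U_i'\subseteq\mathbb R^n$, $i=1,\dots,m$, such that for all $i,j$ and all $e\in E^{i,j}$ the map $g_i\circ f_e\circ g_j^{-1}:U_j'\to U_i'$ has the form $$x\mapsto \beta^{-n_e}R_e\,x+b_e ,$$ where $\beta>1$ is a Pisot number (an algebraic integer all of whose other conjugates have modulus less than one), independent of $e$, $n_e$ is a positive integer, $R_e$ is an orthogonal transformation of $\mathbb R^n$, and $b_e\in\mathbb R^n$. Assume that $\{R_e\}_{e\in E}$ generates a finite group $H$ and that $$H\{b_e: e\in E\}\subseteq r_1\mathbb Z[\beta]\times\cdots\times r_n\mathbb Z[\beta]$$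 for some $r_1,\dots,r_n\in\mathbb R$. Then $G$ is of finite type, and $\mathbf U$ is a finite type condition family of $G$. -/

import Mathlib

open scoped Manifold ContDiff Bundle

/-- A graph-directed iterated function system of contractive similitudes on the metric space `X`,
over a directed multigraph with vertex type `V`; an edge `e : i ⟶ j` starts at `i` and ends at `j`.
The map `f_e` of such an edge is defined on the set `W j` and takes values in `W i`; in particular
`W` is invariant. -/
structure GIFS (V : Type*) [Quiver V] (X : Type*) [MetricSpace X] where
  /-- the domains of the maps -/
  W : V → Set X
  /-- the maps `f_e` -/
  map : ∀ {i j : V}, (i ⟶ j) → W j → W i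
  similitude : ∀ {i j : V} (e : i ⟶ j), ∃ ρ : ℝ, 0 < ρ ∧ ρ < 1 ∧
    ∀ x y : W j, dist (map e x) (map e y) = ρ * dist x y

/-- A Pisot number: an algebraic integer `β > 1` all of whose other conjugates have modulus less
than one. -/
def IsPisot (β : ℝ) : Prop :=
  1 < β ∧ IsIntegral ℤ β ∧
    ∀ z : ℂ, Polynomial.aeval z (minpoly ℚ β) = 0 → z ≠ (β : ℂ) → ‖z‖ < 1

/-- Every point of the metric space `M` has an open neighbourhood isometric to an open subset of
Euclidean `n`-space. -/
def IsLocallyEuclidean (n : ℕ) (M : Type*) [MetricSpace M] : Prop :=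
  ∀ x : M, ∃ O : Set M, IsOpen O ∧ x ∈ O ∧ ∃ φ : M → EuclideanSpace ℝ (Fin n),
    Isometry (O.domRestrict φ) ∧ IsOpen (φ '' O)

/-- `τ` multiplies all distances within `s` by one positive constant. -/
def IsSimilitudeOn {X : Type*} [MetricSpace X] (τ : X → X) (s : Set X) : Prop :=
  ∃ c : ℝ, 0 < c ∧ ∀ x ∈ s, ∀ y ∈ s, dist (τ x) (τ y) = c * dist x y

namespace GIFS

/-- The lengths of the paths in the `k`-th index set. -/
def pathLengths {V : Type*} [Quiver V] (𝓜 : ℕ → ∀ i j : V, Set (Quiver.Path i j)) (k : ℕ) :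
    Set ℕ :=
  {q | ∃ (i j : V) (p : Quiver.Path i j), p ∈ 𝓜 k i j ∧ p.length = q}

/-- A sequence of nested index sets. Here `𝓜 k i j` is the set of those directed paths in the
`k`-th index set that go from `i` to `j`; the index set of level `0` consists of the vertices,
regarded as paths of length zero. -/
structure IsNestedIndexSets {V : Type*} [Quiver V]
    (𝓜 : ℕ → ∀ i j : V, Set (Quiver.Path i j)) : Prop where
  root : ∀ i j : V, 𝓜 0 i j = {p | p.length = 0}
  finite : ∀ k (i j : V), (𝓜 k i j).Finite
  nonempty : ∀ k, (pathLengths 𝓜 k).Nonempty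
  length_pos : ∀ k, 1 ≤ k → ∀ (i j : V), ∀ p ∈ 𝓜 k i j, 1 ≤ p.length
  monotone_min : Monotone fun k => sInf (pathLengths 𝓜 k)
  monotone_max : Monotone fun k => sSup (pathLengths 𝓜 k)
  tendsto_min : Filter.Tendsto (fun k => sInf (pathLengths 𝓜 k)) Filter.atTop Filter.atTop
  tendsto_max : Filter.Tendsto (fun k => sSup (pathLengths 𝓜 k)) Filter.atTop Filter.atTop
  antichain : ∀ k, 1 ≤ k → ∀ (i j l : V) (p : Quiver.Path i j) (r : Quiver.Path j l),
    p ∈ 𝓜 k i j → p.comp r ∈ 𝓜 k i l → r.length = 0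
  exists_prefix : ∀ k (i j : V) (q : Quiver.Path i j), sSup (pathLengths 𝓜 k) < q.length →
    ∃ (l : V) (p : Quiver.Path i l) (r : Quiver.Path l j), p ∈ 𝓜 k i l ∧ q = p.comp r
  exists_extension : ∀ k (i j : V) (q : Quiver.Path i j), 1 ≤ q.length →
    q.length < sInf (pathLengths 𝓜 k) →
    ∃ (l : V) (r : Quiver.Path j l), q.comp r ∈ 𝓜 k i l
  bounded_gap : ∃ L : ℕ, 0 < L ∧ ∀ k (i j l : V) (p : Quiver.Path i j) (r : Quiver.Path j l),
    p ∈ 𝓜 k i j → p.comp r ∈ 𝓜 (k + 1) i l → r.length ≤ L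

variable {V : Type*} [Quiver V] {X : Type*} [MetricSpace X]

/-- The composition `f_{e₁} ∘ ⋯ ∘ f_{e_q}` along a directed path `(e₁, …, e_q)`. -/
def pathMap (G : GIFS V X) {i : V} : ∀ {j : V}, Quiver.Path i j → G.W j → G.W i
  | _, .nil => id
  | _, .cons p e => G.pathMap p ∘ G.map e

/-- `U` is an invariant family of nonempty bounded open sets (on which the maps are defined). -/
structure IsInvariantOpenFamily (G : GIFS V X) (U : V → Set X) : Prop where
  subset : ∀ i, U i ⊆ G.W i
  isOpen : ∀ i, IsOpen (U i)
  nonempty : ∀ i, (U i).Nonempty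
  bounded : ∀ i, Bornology.IsBounded (U i)
  invariant : ∀ {i j : V} (e : i ⟶ j) (x : G.W j), (x : X) ∈ U j → (G.map e x : X) ∈ U i

/-- A quadruple `(f, i, j, k)`; those that occur as `(f_𝐞, i, j, k)` form `vertexSet`. -/
@[ext] structure Vertex (G : GIFS V X) where
  src : V
  tgt : V
  level : ℕ
  map : G.W tgt → G.W src

/-- The set of all vertices `(f_𝐞, i, j, k)` with `𝐞` in the `k`-th index set, going from `i`
to `j`. -/
def vertexSet (G : GIFS V X) (𝓜 : ℕ → ∀ i j : V, Set (Quiver.Path i j)) : Set G.Vertex :=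
  {v | ∃ p ∈ 𝓜 v.level v.src v.tgt, v.map = G.pathMap p}

/-- The set `f_v(W_j)`. -/
def Vertex.range {G : GIFS V X} (v : G.Vertex) : Set X := {y | ∃ x : G.W v.tgt, (v.map x : X) = y}

/-- The set `f_v(U_j)`. -/
def Vertex.image {G : GIFS V X} (v : G.Vertex) (U : V → Set X) : Set X :=
  {y | ∃ x : G.W v.tgt, (x : X) ∈ U v.tgt ∧ (v.map x : X) = y}

/-- The neighbourhood of a vertex with respect to `U`. -/
def neighbourhood (G : GIFS V X) (U : V → Set X) (𝓜 : ℕ → ∀ i j : V, Set (Quiver.Path i j))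
    (v : G.Vertex) : Set G.Vertex :=
  {u | u ∈ G.vertexSet 𝓜 ∧ u.level = v.level ∧ u.src = v.src ∧ (v.image U ∩ u.image U).Nonempty}

/-- `u'` has the same terminal vertex as `u`, and `f_{u'} = τ ∘ f_u`. -/
def Matches {G : GIFS V X} (τ : X → X) (u u' : G.Vertex) : Prop :=
  u'.tgt = u.tgt ∧ ∀ (x : X) (h : x ∈ G.W u.tgt) (h' : x ∈ G.W u'.tgt),
    (u'.map ⟨x, h'⟩ : X) = τ (u.map ⟨x, h⟩)

/-- The directed paths `𝐞` (of positive length, starting at the terminal vertex of `u`) for which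
`(f_u ∘ f_𝐞, k + l)` is a vertex of level `k + l`, where `k` is the level of `u`. -/
def descendants (G : GIFS V X) (𝓜 : ℕ → ∀ i j : V, Set (Quiver.Path i j)) (u : G.Vertex) (l : ℕ) :
    Set (Σ s t : V, Quiver.Path s t) :=
  {a | ∃ (t : V) (p : Quiver.Path u.tgt t), 1 ≤ p.length ∧
    (⟨u.src, t, u.level + l, u.map ∘ G.pathMap p⟩ : G.Vertex) ∈ G.vertexSet 𝓜 ∧
    a = ⟨u.tgt, t, p⟩}

/-- Equivalence of vertices. The map `τ` is `f_{v'} ∘ f_v⁻¹`: on `f_v(W_j)` it is given by this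
formula, and it is a similitude on the union of the sets `f_u(W_{j_u})`, `u` in the neighbourhood
of `v`. -/
def VertexEquiv (G : GIFS V X) (U : V → Set X) (𝓜 : ℕ → ∀ i j : V, Set (Quiver.Path i j))
    (v v' : G.Vertex) : Prop :=
  ∃ τ : X → X,
    IsSimilitudeOn τ (⋃ u ∈ G.neighbourhood U 𝓜 v, u.range) ∧ Matches τ v v' ∧
    ∃ g : G.neighbourhood U 𝓜 v ≃ G.neighbourhood U 𝓜 v',
      (∀ u : G.neighbourhood U 𝓜 v, Matches τ u (g u : G.Vertex)) ∧
      ∀ (u : G.neighbourhood U 𝓜 v) (l : ℕ), 1 ≤ l →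
        G.descendants 𝓜 (u : G.Vertex) l = G.descendants 𝓜 (g u : G.Vertex) l

theorem mem_neighbourhood_self {G : GIFS V X} {U : V → Set X}
    (hU : G.IsInvariantOpenFamily U) {𝓜 : ℕ → ∀ i j : V, Set (Quiver.Path i j)} {v : G.Vertex}
    (hv : v ∈ G.vertexSet 𝓜) : v ∈ G.neighbourhood U 𝓜 v := by
  obtain ⟨x, hx⟩ := hU.nonempty v.tgt
  exact ⟨hv, rfl, rfl, _, ⟨⟨x, hU.subset _ hx⟩, hx, rfl⟩, ⟨⟨x, hU.subset _ hx⟩, hx, rfl⟩⟩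

theorem VertexEquiv.refl (G : GIFS V X) (U : V → Set X)
    (𝓜 : ℕ → ∀ i j : V, Set (Quiver.Path i j)) (v : G.Vertex) : G.VertexEquiv U 𝓜 v v :=
  ⟨id, ⟨1, one_pos, by simp⟩, ⟨rfl, fun _ _ _ => rfl⟩, Equiv.refl _,
    fun _ => ⟨rfl, fun _ _ _ => rfl⟩, fun _ _ _ => rfl⟩

theorem VertexEquiv.trans {G : GIFS V X} {U : V → Set X}
    {𝓜 : ℕ → ∀ i j : V, Set (Quiver.Path i j)} {v₁ v₂ v₃ : G.Vertex}
    (h : G.VertexEquiv U 𝓜 v₁ v₂) (h' : G.VertexEquiv U 𝓜 v₂ v₃) : G.VertexEquiv U 𝓜 v₁ v₃ := by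
  obtain ⟨τ, ⟨c, hc, hτ⟩, hm, g, hg, hd⟩ := h
  obtain ⟨τ', ⟨c', hc', hτ'⟩, hm', g', hg', hd'⟩ := h'
  have key : ∀ {u u' u'' : G.Vertex}, Matches τ u u' → Matches τ' u' u'' →
      Matches (τ' ∘ τ) u u'' := by
    rintro u u' u'' ⟨e, h⟩ ⟨e', h'⟩
    refine ⟨e'.trans e, fun x hx hx'' => ?_⟩
    have hx' : x ∈ G.W u'.tgt := e.symm ▸ hx
    rw [h' x hx' hx'', h x hx hx', Function.comp]
  have maps : ∀ x ∈ ⋃ u ∈ G.neighbourhood U 𝓜 v₁, u.range,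
      τ x ∈ ⋃ u ∈ G.neighbourhood U 𝓜 v₂, u.range := by
    intro x hx
    simp only [Set.mem_iUnion] at hx ⊢
    obtain ⟨u, hu, ⟨y, hy⟩, rfl⟩ := hx
    obtain ⟨e, h⟩ := hg ⟨u, hu⟩
    have hy' : y ∈ G.W (g ⟨u, hu⟩ : G.Vertex).tgt := e.symm ▸ hy
    exact ⟨g ⟨u, hu⟩, (g ⟨u, hu⟩).2, ⟨y, hy'⟩, h y hy hy'⟩
  refine ⟨τ' ∘ τ, ⟨c' * c, mul_pos hc' hc, fun x hx y hy => ?_⟩, key hm hm', g.trans g',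
    fun u => key (hg u) (hg' (g u)), fun u l hl => (hd u l hl).trans (hd' (g u) l hl)⟩
  rw [Function.comp, Function.comp, hτ' _ (maps x hx) _ (maps y hy), hτ x hx y hy, mul_assoc]

theorem VertexEquiv.symm {G : GIFS V X} {U : V → Set X} (hU : G.IsInvariantOpenFamily U)
    {𝓜 : ℕ → ∀ i j : V, Set (Quiver.Path i j)} {v v' : G.Vertex} (hv : v ∈ G.vertexSet 𝓜)
    (h : G.VertexEquiv U 𝓜 v v') : G.VertexEquiv U 𝓜 v' v := by
  obtain ⟨τ, ⟨c, hc, hτ⟩, hm, g, hg, hd⟩ := h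
  set D := ⋃ u ∈ G.neighbourhood U 𝓜 v, u.range with hD
  have : Nonempty X := ⟨(hU.nonempty v.tgt).choose⟩
  have inj : Set.InjOn τ D := fun x hx y hy hxy => by
    have h0 := hτ x hx y hy
    rw [hxy, dist_self, zero_eq_mul] at h0
    exact dist_eq_zero.1 (h0.resolve_left hc.ne')
  set σ := Function.invFunOn τ D with hσ
  have hστ : ∀ x ∈ D, σ (τ x) = x := fun x hx => inj.leftInvOn_invFunOn hx
  have mem : ∀ u ∈ G.neighbourhood U 𝓜 v, ∀ x : G.W u.tgt, (u.map x : X) ∈ D := fun u hu x => by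
    simp only [hD, Set.mem_iUnion]
    exact ⟨u, hu, x, rfl⟩
  have key : ∀ {u u' : G.Vertex}, u ∈ G.neighbourhood U 𝓜 v → Matches τ u u' →
      Matches σ u' u := by
    rintro u u' hu ⟨e, h⟩
    refine ⟨e.symm, fun x hx' hx => ?_⟩
    rw [h x hx hx', hστ _ (mem u hu _)]
  have surj : ∀ y ∈ ⋃ u ∈ G.neighbourhood U 𝓜 v', u.range, ∃ x ∈ D, τ x = y := by
    intro y hy
    simp only [Set.mem_iUnion] at hy
    obtain ⟨u', hu', ⟨x, hx'⟩, rfl⟩ := hy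
    obtain ⟨⟨u, hu⟩, h⟩ := g.surjective ⟨u', hu'⟩
    have hgu := hg ⟨u, hu⟩
    rw [h] at hgu
    obtain ⟨e, h⟩ := hgu
    have hx : x ∈ G.W u.tgt := by
      have e' : u'.tgt = u.tgt := e
      exact e' ▸ hx'
    exact ⟨u.map ⟨x, hx⟩, mem u hu _, (h x hx hx').symm⟩
  refine ⟨σ, ⟨c⁻¹, inv_pos.2 hc, ?_⟩, key (mem_neighbourhood_self hU hv) hm, g.symm, ?_, ?_⟩
  · intro y hy y' hy'
    obtain ⟨x, hx, rfl⟩ := surj y hy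
    obtain ⟨x', hx', rfl⟩ := surj y' hy'
    rw [hστ x hx, hστ x' hx', hτ x hx x' hx', inv_mul_cancel_left₀ hc.ne']
  · intro u'
    have h := hg (g.symm u')
    rw [Equiv.apply_symm_apply] at h
    exact key (g.symm u').2 h
  · intro u' l hl
    have h := hd (g.symm u') l hl
    rw [Equiv.apply_symm_apply] at h
    exact h.symm

/-- The equivalence relation on the vertex set; its classes are the neighbourhood types. -/
def vertexSetoid {G : GIFS V X} {U : V → Set X} (hU : G.IsInvariantOpenFamily U)
    (𝓜 : ℕ → ∀ i j : V, Set (Quiver.Path i j)) : Setoid (G.vertexSet 𝓜) where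
  r v v' := G.VertexEquiv U 𝓜 v v'
  iseqv :=
    { refl := fun v => VertexEquiv.refl G U 𝓜 v
      symm := fun {v _} h => VertexEquiv.symm hU v.2 h
      trans := fun h h' => VertexEquiv.trans h h' }

/-- `U` is a finite type condition family of `G`: an invariant family of nonempty bounded open sets
with finitely many neighbourhood types, for some sequence of nested index sets. -/
def IsFiniteTypeFamily (G : GIFS V X) (U : V → Set X) : Prop :=
  ∃ (hU : G.IsInvariantOpenFamily U) (𝓜 : ℕ → ∀ i j : V, Set (Quiver.Path i j)),
    IsNestedIndexSets 𝓜 ∧ Finite (Quotient (vertexSetoid hU 𝓜))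

/-- The graph finite type condition. -/
def IsFiniteType (G : GIFS V X) : Prop := ∃ U : V → Set X, G.IsFiniteTypeFamily U

end GIFS

/-! Cut every path where the sum of its exponents $n_e$ first reaches $k$, and let $K$ bound all
$n_e$. Maps of level $k$ then have ratio between $\beta^{-k-K}$ and $\beta^{-k}$, so for two paths
$p,q$ of level $k$ with the same source, the similitude $f_p^{-1}\circ f_q$, read in coordinates,
has a ratio and a rotation from finite sets.

Its translation part is bounded when the images meet. Each coordinate of it is $r_c$ times an
integer polynomial in $\beta$, assembled from finitely many pieces, one for each edge of a path. At
a conjugate $\gamma\ne\beta$ this polynomial is dominated by a geometric series, because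
$|\gamma|<1$; at $\beta$ it is bounded by assumption. Only finitely many algebraic integers of
$\mathbb Q(\beta)$ have all conjugates bounded, so finitely many translations occur
(`finite_relTrans`), and hence finitely many configurations of nearby paths (`typeData`).

Equal configurations give equivalent vertices (`vertexEquiv_pathVertex`). Images of $U$ under paths
from $i$ lie in $U_i$, where one chart is isometric; equal relative coordinates therefore force
proportional distances in $M$, first on $U$ and then on $W=\overline U$ by density. A configuration
has to contain neighbours of neighbours, since a descendant of a neighbour may come from a path that
does not extend that neighbour. -/

section Cut

/-! ### Index sets obtained by cutting paths at a given weight. -/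

variable {V : Type*} [Quiver V] (w : ∀ i j : V, (i ⟶ j) → ℕ)

/-- The total weight of a directed path. -/
def pathWeight {i : V} : ∀ {j : V}, Quiver.Path i j → ℕ
  | _, .nil => 0
  | _, .cons p e => pathWeight p + w _ _ e

/-- A path belongs to the cut of level `k` if its weight is at least `k`, while that of every proper
initial segment is less than `k`. -/
def IsCut (k : ℕ) {i : V} : ∀ {j : V}, Quiver.Path i j → Prop
  | _, .nil => k = 0
  | _, .cons p e => pathWeight w p < k ∧ k ≤ pathWeight w p + w _ _ e

theorem pathWeight_comp {i j l : V} (p : Quiver.Path i j) (q : Quiver.Path j l) :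
    pathWeight w (p.comp q) = pathWeight w p + pathWeight w q := by
  induction q with
  | nil => simp [pathWeight]
  | cons q e ih => simp [pathWeight, ih, add_assoc]

theorem pathWeight_le_length_mul {K : ℕ} (hK : ∀ {i j : V} (e : i ⟶ j), w i j e ≤ K) {i j : V}
    (p : Quiver.Path i j) : pathWeight w p ≤ p.length * K := by
  induction p with
  | nil => simp [pathWeight]
  | cons p e ih =>
    have := hK e
    simp only [pathWeight, Quiver.Path.length_cons, add_mul, one_mul]
    omega

variable {w} {k k' : ℕ}

theorem IsCut.le_pathWeight {i j : V} {p : Quiver.Path i j} (h : IsCut w k p) :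
    k ≤ pathWeight w p := by
  cases p with
  | nil => exact h.le
  | cons p e => exact h.2

theorem IsCut.pathWeight_le {K : ℕ} (hK : ∀ {i j : V} (e : i ⟶ j), w i j e ≤ K) {i j : V}
    {p : Quiver.Path i j} (h : IsCut w k p) : pathWeight w p ≤ k + K := by
  cases p with
  | nil => simp [pathWeight]
  | cons p e =>
    have := hK e
    have := h.1
    simp only [pathWeight]
    omega

theorem IsCut.mono {i j : V} {p : Quiver.Path i j} (h : IsCut w k p) (hk : k ≤ k')
    (hp : k' ≤ pathWeight w p) : IsCut w k' p := by
  cases p with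
  | nil => exact Nat.le_zero.1 hp
  | cons p e => exact ⟨h.1.trans_le hk, hp⟩

/-- Whether an extension of a path in a cut lies in a later cut depends on the weights only. -/
theorem IsCut.comp_of_pathWeight_eq {i i' j l : V} {p : Quiver.Path i j} {p' : Quiver.Path i' j}
    {r : Quiver.Path j l} {q : ℕ} (hp' : IsCut w k' p')
    (hw : pathWeight w p + k' = pathWeight w p' + k) (h : IsCut w (k + q) (p.comp r)) :
    IsCut w (k' + q) (p'.comp r) := by
  cases r with
  | nil =>
    have := h.le_pathWeight
    simp only [Quiver.Path.comp_nil] at this ⊢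
    exact hp'.mono (by omega) (by omega)
  | cons r e =>
    simp only [Quiver.Path.comp_cons, IsCut, pathWeight_comp] at h ⊢
    omega

theorem exists_isCut_prefix {i j : V} (p : Quiver.Path i j) (h : k ≤ pathWeight w p) :
    ∃ (l : V) (q : Quiver.Path i l) (r : Quiver.Path l j), IsCut w k q ∧ p = q.comp r := by
  induction p with
  | nil => exact ⟨i, .nil, .nil, Nat.le_zero.1 h, rfl⟩
  | cons p e ih =>
    by_cases hk : k ≤ pathWeight w p
    · obtain ⟨l, q, r, hq, rfl⟩ := ih hk
      exact ⟨l, q, r.cons e, hq, rfl⟩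
    · exact ⟨_, p.cons e, .nil, ⟨not_le.1 hk, h⟩, rfl⟩

section Pos

variable (hw : ∀ {i j : V} (e : i ⟶ j), 0 < w i j e)
include hw

theorem length_le_pathWeight {i j : V} (p : Quiver.Path i j) : p.length ≤ pathWeight w p := by
  induction p with
  | nil => simp
  | cons p e ih =>
    have := hw e
    simp only [pathWeight, Quiver.Path.length_cons]
    omega

/-- Positivity of the last weight makes every proper prefix lighter. This lets inductions over
prefixes use a statement about cuts. -/
theorem isCut_pathWeight {i j : V} (p : Quiver.Path i j) : IsCut w (pathWeight w p) p := by
  cases p with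
  | nil => rfl
  | cons p e => exact ⟨Nat.lt_add_of_pos_right (hw e), le_rfl⟩

theorem IsCut.length_le {i j : V} {p : Quiver.Path i j} (h : IsCut w k p) : p.length ≤ k := by
  cases p with
  | nil => simp
  | cons p e => exact (length_le_pathWeight hw p).trans_lt h.1

theorem exists_isCut_extension (hV : ∀ i : V, ∃ j : V, Nonempty (i ⟶ j)) {i j : V}
    (p : Quiver.Path i j) (h : pathWeight w p < k) :
    ∃ (l : V) (r : Quiver.Path j l), IsCut w k (p.comp r) := by
  induction hd : k - pathWeight w p using Nat.strong_induction_on generalizing j with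
  | _ d ih =>
    obtain ⟨l, ⟨e⟩⟩ := hV j
    by_cases hk : k ≤ pathWeight w p + w _ _ e
    · exact ⟨l, Quiver.Path.nil.cons e, h, hk⟩
    · have := hw e
      obtain ⟨t, r, hr⟩ := ih (k - pathWeight w (p.cons e)) (by simp only [pathWeight]; omega)
        (p.cons e) (not_le.1 hk) rfl
      exact ⟨t, e.toPath.comp r, by rwa [← Quiver.Path.comp_assoc]⟩

end Pos

theorem finite_setOf_length_eq [Finite V] [∀ i j : V, Finite (i ⟶ j)] (n : ℕ) (i j : V) :
    {p : Quiver.Path i j | p.length = n}.Finite := by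
  induction n generalizing j with
  | zero =>
    refine Set.Subsingleton.finite fun p hp q hq => ?_
    obtain rfl := Quiver.Path.eq_of_length_zero p hp
    rw [Quiver.Path.eq_nil_of_length_zero p hp, Quiver.Path.eq_nil_of_length_zero q hq]
  | succ n ih =>
    refine (Set.finite_iUnion fun l : V => Set.finite_iUnion fun e : l ⟶ j =>
      (ih l).image fun p => p.cons e).subset fun p hp => ?_
    cases p with
    | nil => simp at hp
    | cons p e =>
      simp only [Set.mem_iUnion]
      exact ⟨_, e, p, by simpa using hp, rfl⟩

/-- The cuts form a sequence of nested index sets. -/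
theorem isNestedIndexSets_isCut [Finite V] [Nonempty V] [∀ i j : V, Finite (i ⟶ j)]
    (hV : ∀ i : V, ∃ j : V, Nonempty (i ⟶ j)) (hw : ∀ {i j : V} (e : i ⟶ j), 0 < w i j e) {K : ℕ}
    (hK : ∀ {i j : V} (e : i ⟶ j), w i j e ≤ K) :
    GIFS.IsNestedIndexSets fun k (i j : V) => {p : Quiver.Path i j | IsCut w k p} := by
  set 𝓜 := fun k (i j : V) => {p : Quiver.Path i j | IsCut w k p}
  have mem : ∀ {k : ℕ} {i j : V} {p : Quiver.Path i j}, IsCut w k p →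
      p.length ∈ GIFS.pathLengths 𝓜 k := fun h => ⟨_, _, _, h, rfl⟩
  have bdd : ∀ k, BddAbove (GIFS.pathLengths 𝓜 k) := by
    rintro k
    refine ⟨k, ?_⟩
    rintro _ ⟨i, j, p, hp, rfl⟩
    exact IsCut.length_le hw hp
  have nonempty : ∀ k, (GIFS.pathLengths 𝓜 k).Nonempty := by
    intro k
    obtain ⟨i⟩ := ‹Nonempty V›
    rcases Nat.eq_zero_or_pos k with rfl | hk
    · exact ⟨_, mem (p := (Quiver.Path.nil : Quiver.Path i i)) rfl⟩
    · obtain ⟨l, r, hr⟩ := exists_isCut_extension hw hV (Quiver.Path.nil : Quiver.Path i i) hk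
      exact ⟨_, mem hr⟩
  have tendsto : Filter.Tendsto (fun k => sInf (GIFS.pathLengths 𝓜 k)) Filter.atTop
      Filter.atTop := by
    refine Filter.tendsto_atTop.2 fun a => ?_
    -- A path of weight more than $aK$ has more than $a$ edges.
    filter_upwards [Filter.eventually_gt_atTop (a * K)] with k hk
    obtain ⟨i, j, p, hp, h⟩ := Nat.sInf_mem (nonempty k)
    rw [← h]
    have h1 := (IsCut.le_pathWeight hp).trans (pathWeight_le_length_mul w hK p)
    exact (Nat.lt_of_mul_lt_mul_right (hk.trans_le h1)).le
  refine ⟨?_, ?_, nonempty, ?_, ?_, ?_, tendsto, ?_, ?_, ?_, ?_, 1, one_pos, ?_⟩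
  · intro i j
    ext p
    cases p with
    | nil => simp [𝓜, IsCut]
    | cons p e => simp [𝓜, IsCut]
  · intro k i j
    refine (Set.finite_iUnion fun n : Fin (k + 1) => finite_setOf_length_eq n i j).subset ?_
    intro p hp
    exact Set.mem_iUnion.2 ⟨⟨p.length, Nat.lt_succ_of_le (IsCut.length_le hw hp)⟩, rfl⟩
  · intro k hk i j p hp
    cases p with
    | nil => exact absurd hp (by simpa [𝓜, IsCut] using Nat.ne_of_gt hk)
    | cons p e => simp
  · intro k k' hk
    obtain ⟨i, j, p, hp, h⟩ := Nat.sInf_mem (nonempty k')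
    obtain ⟨l, q, r, hq, rfl⟩ := exists_isCut_prefix p (hk.trans (IsCut.le_pathWeight hp))
    refine (Nat.sInf_le (mem hq)).trans (le_of_le_of_eq ?_ h)
    simp
  · intro k k' hk
    obtain ⟨i, j, p, hp, h⟩ := Nat.sSup_mem (nonempty k) (bdd k)
    refine (le_of_eq h.symm).trans ?_
    by_cases hk' : k' ≤ pathWeight w p
    · exact le_csSup (bdd k') (mem (IsCut.mono hp hk hk'))
    · obtain ⟨l, r, hr⟩ := exists_isCut_extension hw hV p (not_le.1 hk')
      exact le_trans (by simp) (le_csSup (bdd k') (mem hr))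
  · exact Filter.tendsto_atTop_mono (fun k => csInf_le_csSup (nonempty k)
      (OrderBot.bddBelow _) (bdd k)) tendsto
  · intro k hk i j l p r hp hr
    cases r with
    | nil => rfl
    | cons r e =>
      have h1 := IsCut.le_pathWeight hp
      have h2 := hr.1
      rw [pathWeight_comp] at h2
      omega
  · intro k i j q hq
    by_cases hk : k ≤ pathWeight w q
    · exact exists_isCut_prefix q hk
    · obtain ⟨l, r, hr⟩ := exists_isCut_extension hw hV q (not_le.1 hk)
      have := le_csSup (bdd k) (mem hr)
      rw [Quiver.Path.length_comp] at this
      omega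
  · intro k i j q _ hq
    refine exists_isCut_extension hw hV q (not_le.1 fun hk => ?_)
    obtain ⟨l, p, r, hp, rfl⟩ := exists_isCut_prefix q hk
    have := Nat.sInf_le (mem hp)
    rw [Quiver.Path.length_comp] at hq
    omega
  -- The gap is at most $1$: the part of the extension before its last edge has weight less than
  -- $(k+1)-k$, so it is empty.
  · intro k i j l p r hp hr
    cases r with
    | nil => simp
    | cons r e =>
      have h1 := IsCut.le_pathWeight hp
      have h2 := hr.1
      have h3 := length_le_pathWeight hw r
      rw [pathWeight_comp] at h2
      simp only [Quiver.Path.length_cons]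
      omega

end Cut

/-! ### Algebraic integers with bounded conjugates. -/

/-- A Pisot number takes only finitely many bounded values at integer polynomials whose values at
the other conjugates are bounded. -/
theorem IsPisot.finite_polynomial_values {β : ℝ} (hβ : IsPisot β) (B : ℝ) (D : ℂ → ℝ) :
    {z : ℝ | |z| ≤ B ∧ ∃ P : Polynomial ℤ, Polynomial.aeval β P = z ∧
      ∀ γ : ℂ, Polynomial.aeval γ (minpoly ℚ β) = 0 → γ ≠ β →
        ‖Polynomial.aeval γ P‖ ≤ D γ}.Finite := by
  obtain ⟨-, hint, -⟩ := hβ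
  have hintQ : IsIntegral ℚ β := hint.tower_top
  let K := IntermediateField.adjoin ℚ ({β} : Set ℝ)
  have : FiniteDimensional ℚ K := IntermediateField.adjoin.finiteDimensional hintQ
  have : NumberField K := ⟨⟩
  let θ : K := IntermediateField.AdjoinSimple.gen ℚ β
  have hθ : algebraMap K ℝ θ = β := rfl
  have hθint : IsIntegral ℤ θ := by
    rw [← isIntegral_algebraMap_iff (algebraMap K ℝ).injective]
    exact hint
  obtain ⟨C, hC⟩ := (Set.finite_range fun φ : K →+* ℂ => D (φ θ)).bddAbove
  refine ((NumberField.Embeddings.finite_of_norm_le K ℂ (max B C)).image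
    (algebraMap K ℝ)).subset ?_
  rintro z ⟨hz, P, rfl, hP⟩
  refine ⟨Polynomial.aeval θ P, ⟨?_, fun φ => ?_⟩, ?_⟩
  · exact adjoin_le_integralClosure hθint (Polynomial.aeval_mem_adjoin_singleton ℤ θ)
  · have hφ : φ (Polynomial.aeval θ P) = Polynomial.aeval (φ θ) P :=
      (Polynomial.aeval_algHom_apply φ.toIntAlgHom θ P).symm
    rw [hφ]
    -- An embedding of $\mathbb Q(\beta)$ sends $\beta$ either to itself, where `B` bounds the
    -- value, or to another conjugate, where `D` does.
    by_cases h : φ θ = β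
    · rw [h]
      refine le_trans (le_of_eq ?_) (hz.trans (le_max_left _ _))
      have := Polynomial.aeval_algHom_apply Complex.ofRealHom.toIntAlgHom β P
      simp only [RingHom.toIntAlgHom_apply, Complex.ofRealHom_eq_coe] at this
      rw [this, Complex.norm_real, Real.norm_eq_abs]
    · refine (hP _ ?_ h).trans ((hC ⟨φ, rfl⟩).trans (le_max_right _ _))
      have h1 : minpoly ℚ β = minpoly ℚ θ := minpoly.algebraMap_eq (algebraMap K ℝ).injective θ
      have := Polynomial.aeval_algHom_apply φ.toRatAlgHom θ (minpoly ℚ θ)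
      simp only [RingHom.toRatAlgHom_apply, minpoly.aeval, map_zero] at this
      rw [h1, this]
  · exact (Polynomial.aeval_algebraMap_apply ℝ θ P).symm

/-! ### Path maps and their relative positions in Euclidean coordinates. -/

namespace GIFS

variable {V : Type*} [Quiver V] {X : Type*} [MetricSpace X]

/-- Coordinates `U i → ℝⁿ` in which the maps of a GIFS are of the form `x ↦ β⁻ᵏ • R x + b`. -/
structure EuclideanModel (G : GIFS V X) (U : V → Set X) (n : ℕ) where
  chart : V → X → EuclideanSpace ℝ (Fin n)
  isometry : ∀ i, Isometry ((U i).domRestrict (chart i))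
  β : ℝ
  one_lt : 1 < β
  weight : ∀ i j : V, (i ⟶ j) → ℕ
  weight_pos : ∀ {i j : V} (e : i ⟶ j), 0 < weight i j e
  rot : ∀ {i j : V}, (i ⟶ j) → (EuclideanSpace ℝ (Fin n) ≃ₗᵢ[ℝ] EuclideanSpace ℝ (Fin n))
  trans : ∀ {i j : V}, (i ⟶ j) → EuclideanSpace ℝ (Fin n)
  conj : ∀ {i j : V} (e : i ⟶ j) (x : G.W j), (x : X) ∈ U j →
    chart i (G.map e x) = (β ^ weight i j e)⁻¹ • rot e (chart j x) + trans e

namespace EuclideanModel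

variable {G : GIFS V X} {U : V → Set X} {n : ℕ} (F : G.EuclideanModel U n)

noncomputable section

/-- The linear isometry part of the map of a path, in coordinates. -/
def pathRot {i : V} : ∀ {j : V}, Quiver.Path i j →
    (EuclideanSpace ℝ (Fin n) ≃ₗᵢ[ℝ] EuclideanSpace ℝ (Fin n))
  | _, .nil => 1
  | _, .cons p e => pathRot p * F.rot e

/-- The translation part of the map of a path, in coordinates. -/
def pathTrans {i : V} : ∀ {j : V}, Quiver.Path i j → EuclideanSpace ℝ (Fin n)
  | _, .nil => 0
  | _, .cons p e => pathTrans p + (F.β ^ pathWeight F.weight p)⁻¹ • F.pathRot p (F.trans e)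

theorem β_pow_pos (m : ℕ) : 0 < F.β ^ m := pow_pos (zero_lt_one.trans F.one_lt) m

theorem pathMap_mem (hU : G.IsInvariantOpenFamily U) {i j : V} (p : Quiver.Path i j) (x : G.W j)
    (hx : (x : X) ∈ U j) : (G.pathMap p x : X) ∈ U i := by
  induction p with
  | nil => exact hx
  | cons p e ih => exact ih _ (hU.invariant e x hx)

theorem chart_pathMap (hU : G.IsInvariantOpenFamily U) {i j : V} (p : Quiver.Path i j) (x : G.W j)
    (hx : (x : X) ∈ U j) : F.chart i (G.pathMap p x) =
      (F.β ^ pathWeight F.weight p)⁻¹ • F.pathRot p (F.chart j x) + F.pathTrans p := by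
  induction p with
  | nil => simp [pathMap, pathWeight, pathRot, pathTrans]
  | cons p e ih =>
    have h := ih _ (hU.invariant e x hx)
    simp only [pathMap, Function.comp, pathWeight, pathRot, pathTrans]
    rw [h, F.conj e x hx]
    simp only [map_add, map_smul, smul_add, smul_smul, pow_add, mul_inv,
      LinearIsometryEquiv.coe_mul, Function.comp]
    abel

/-- The translation part of `f_p⁻¹ ∘ f_q`, in coordinates. -/
def relTrans {i j l : V} (p : Quiver.Path i j) (q : Quiver.Path i l) :
    EuclideanSpace ℝ (Fin n) :=
  F.β ^ pathWeight F.weight p • (F.pathRot p)⁻¹ (F.pathTrans q - F.pathTrans p)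

theorem relTrans_self {i j : V} (p : Quiver.Path i j) : F.relTrans p p = 0 := by
  simp [relTrans]

theorem norm_relTrans {i j l : V} (p : Quiver.Path i j) (q : Quiver.Path i l) :
    ‖F.relTrans p q‖ = F.β ^ pathWeight F.weight p * ‖F.pathTrans q - F.pathTrans p‖ := by
  rw [relTrans, norm_smul, Real.norm_of_nonneg (F.β_pow_pos _).le, LinearIsometryEquiv.norm_map]

/-- The map `f_p⁻¹ ∘ f_q`, in coordinates. -/
def relMap {i j l : V} (p : Quiver.Path i j) (q : Quiver.Path i l)
    (x : EuclideanSpace ℝ (Fin n)) : EuclideanSpace ℝ (Fin n) :=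
  (F.β ^ pathWeight F.weight p * (F.β ^ pathWeight F.weight q)⁻¹) •
    ((F.pathRot p)⁻¹ * F.pathRot q) x + F.relTrans p q

theorem chart_pathMap_eq_relMap (hU : G.IsInvariantOpenFamily U) {i j l : V}
    (p : Quiver.Path i j) (q : Quiver.Path i l) (x : G.W l) (hx : (x : X) ∈ U l) :
    F.chart i (G.pathMap q x) = (F.β ^ pathWeight F.weight p)⁻¹ •
      F.pathRot p (F.relMap p q (F.chart l x)) + F.pathTrans p := by
  have h : ∀ y, F.pathRot p ((F.pathRot p)⁻¹ y) = y := fun y => (F.pathRot p).apply_symm_apply y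
  have h0 := (F.β_pow_pos (pathWeight F.weight p)).ne'
  simp only [F.chart_pathMap hU q x hx, relMap, relTrans, map_add, map_smul, smul_add, smul_smul,
    LinearIsometryEquiv.coe_mul, Function.comp, h, inv_mul_cancel_left₀ h0, inv_mul_cancel₀ h0,
    one_smul]
  abel

/-- Both points lie in `U i`, where a single chart is isometric, and that chart is `relMap` followed
by a similitude of ratio $\beta^{-w(p)}$. Thus distances in the space depend only on relative
coordinates. -/
theorem dist_pathMap_eq (hU : G.IsInvariantOpenFamily U) {i j l l' : V} (p : Quiver.Path i j)
    (q : Quiver.Path i l) (q' : Quiver.Path i l') (x : G.W l) (hx : (x : X) ∈ U l) (y : G.W l')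
    (hy : (y : X) ∈ U l') :
    F.β ^ pathWeight F.weight p * dist (G.pathMap q x) (G.pathMap q' y) =
      dist (F.relMap p q (F.chart l x)) (F.relMap p q' (F.chart l' y)) := by
  have h := (F.isometry i).dist_eq ⟨_, pathMap_mem hU q x hx⟩ ⟨_, pathMap_mem hU q' y hy⟩
  simp only [Set.domRestrict_apply, Subtype.dist_eq] at h
  rw [Subtype.dist_eq, ← h, F.chart_pathMap_eq_relMap hU p q x hx,
    F.chart_pathMap_eq_relMap hU p q' y hy, dist_add_right, dist_smul₀,
    LinearIsometryEquiv.dist_map, norm_inv, Real.norm_of_nonneg (F.β_pow_pos _).le,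
    mul_inv_cancel_left₀ (F.β_pow_pos _).ne']

/-- The images of `U` under the maps of the two paths meet. -/
def Overlap (G : GIFS V X) (U : V → Set X) {i j l : V} (p : Quiver.Path i j)
    (q : Quiver.Path i l) : Prop :=
  ∃ x : G.W j, (x : X) ∈ U j ∧ ∃ y : G.W l, (y : X) ∈ U l ∧ G.pathMap p x = G.pathMap q y

/-- A common point of the two images is within $\rho\beta^{-k}$ of both translation parts. -/
theorem norm_pathTrans_sub_le (hU : G.IsInvariantOpenFamily U) {ρ : ℝ}
    (hρ : ∀ i, ∀ x ∈ U i, ‖F.chart i x‖ ≤ ρ) {i j l k : _} {p : Quiver.Path i j}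
    {q : Quiver.Path i l} (hp : IsCut F.weight k p) (hq : IsCut F.weight k q)
    (h : Overlap G U p q) : ‖F.pathTrans q - F.pathTrans p‖ ≤ 2 * ρ * (F.β ^ k)⁻¹ := by
  obtain ⟨x, hx, y, hy, hxy⟩ := h
  have key : ∀ {j : V} {p : Quiver.Path i j} (_ : IsCut F.weight k p) (x : G.W j)
      (_ : (x : X) ∈ U j), ‖F.chart i (G.pathMap p x) - F.pathTrans p‖ ≤ ρ * (F.β ^ k)⁻¹ := by
    intro j p hp x hx
    rw [F.chart_pathMap hU p x hx, add_sub_cancel_right, norm_smul, LinearIsometryEquiv.norm_map,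
      norm_inv, Real.norm_of_nonneg (F.β_pow_pos _).le, mul_comm]
    have h1 := hρ j x hx
    have h2 := (norm_nonneg _).trans h1
    have h3 := F.β_pow_pos k
    have h4 := pow_le_pow_right₀ F.one_lt.le hp.le_pathWeight
    exact mul_le_mul h1 (inv_anti₀ h3 h4) (inv_pos.2 (F.β_pow_pos _)).le h2
  have h1 := key hp x hx
  have h2 := key hq y hy
  rw [← hxy] at h2
  calc ‖F.pathTrans q - F.pathTrans p‖
      = ‖(F.chart i (G.pathMap p x) - F.pathTrans p) -
          (F.chart i (G.pathMap p x) - F.pathTrans q)‖ := by congr 1; abel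
    _ ≤ _ := norm_sub_le _ _
    _ ≤ _ := by linarith

/-- Neighbours of neighbours are at bounded relative distance. -/
theorem norm_relTrans_le (hU : G.IsInvariantOpenFamily U) {ρ : ℝ}
    (hρ : ∀ i, ∀ x ∈ U i, ‖F.chart i x‖ ≤ ρ) {K : ℕ}
    (hK : ∀ {i j : V} (e : i ⟶ j), F.weight i j e ≤ K) {i j l s : V} {k : ℕ}
    {v : Quiver.Path i j} {p : Quiver.Path i l} {q : Quiver.Path i s} (hv : IsCut F.weight k v)
    (hp : IsCut F.weight k p) (hq : IsCut F.weight k q) (h : Overlap G U v p)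
    (h' : Overlap G U p q) : ‖F.relTrans v q‖ ≤ 4 * ρ * F.β ^ K := by
  -- Two overlaps cost $2\rho\beta^{-k}$ each; rescaling by $\beta^{w(v)}\le\beta^{k+K}$ gives
  -- $4\rho\beta^K$.
  have h1 := F.norm_pathTrans_sub_le hU hρ hv hp h
  have h2 := F.norm_pathTrans_sub_le hU hρ hp hq h'
  have h3 : ‖F.pathTrans q - F.pathTrans v‖ ≤ 4 * ρ * (F.β ^ k)⁻¹ := by
    have := norm_sub_le_norm_sub_add_norm_sub (F.pathTrans q) (F.pathTrans p) (F.pathTrans v)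
    linarith
  have h4 := pow_le_pow_right₀ F.one_lt.le (hv.pathWeight_le hK)
  have h5 := F.β_pow_pos k
  rw [norm_relTrans]
  calc _ ≤ F.β ^ (k + K) * (4 * ρ * (F.β ^ k)⁻¹) := by gcongr; exact (F.β_pow_pos _).le
    _ = _ := by rw [pow_add]; field_simp

/-! ### Finiteness of the relative translations. -/

section Finiteness

variable {H : Subgroup (EuclideanSpace ℝ (Fin n) ≃ₗᵢ[ℝ] EuclideanSpace ℝ (Fin n))}
  (hrot : ∀ {i j : V} (e : i ⟶ j), F.rot e ∈ H)
include hrot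

theorem pathRot_mem {i j : V} (p : Quiver.Path i j) : F.pathRot p ∈ H := by
  induction p with
  | nil => exact H.one_mem
  | cons p e ih => exact H.mul_mem ih (hrot e)

/-- The coordinates of `β ^ N • h (pathTrans p)` are integer polynomials in `β` whose coefficients
come from a finite set; their values at points of the open unit disc are therefore bounded. -/
theorem exists_polynomial_pathTrans (r : Fin n → ℝ)
    (P : H → ∀ {i j : V}, (i ⟶ j) → Fin n → Polynomial ℤ)
    (hP : ∀ (h : H) {i j : V} (e : i ⟶ j) (c : Fin n),
      (h : EuclideanSpace ℝ (Fin n) ≃ₗᵢ[ℝ] EuclideanSpace ℝ (Fin n)) (F.trans e) c =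
        r c * Polynomial.aeval F.β (P h e c))
    (h : H) (c : Fin n) {i j : V} (p : Quiver.Path i j) (N : ℕ)
    {k : ℕ} (hp : IsCut F.weight k p) (hN : k ≤ N + 1) :
    ∃ Q : Polynomial ℤ, F.β ^ N *
        (h : EuclideanSpace ℝ (Fin n) ≃ₗᵢ[ℝ] EuclideanSpace ℝ (Fin n)) (F.pathTrans p) c =
        r c * Polynomial.aeval F.β Q ∧
      ∀ (γ : ℂ) (C : ℝ), ‖γ‖ < 1 →
        (∀ (h : H) {i j : V} (e : i ⟶ j) (c : Fin n), ‖Polynomial.aeval γ (P h e c)‖ ≤ C) →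
        0 ≤ C → ‖Polynomial.aeval γ Q‖ ≤
          C / (1 - ‖γ‖) * ‖γ‖ ^ (N + 1 - k) := by
  induction p generalizing k with
  | nil =>
    refine ⟨0, by simp [pathTrans], fun γ C hγ _ hC => ?_⟩
    have : 0 < 1 - ‖γ‖ := sub_pos.2 hγ
    simp only [map_zero, norm_zero]
    positivity
  | cons p e ih =>
    have hlt : pathWeight F.weight p < k := hp.1
    obtain ⟨Q, hQ, hQ'⟩ := ih (isCut_pathWeight F.weight_pos p) (by omega)
    -- The rotation of the prefix is absorbed into the group element, which is why `P` is indexed by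
    -- all of `H`.
    let g : H := h * ⟨F.pathRot p, F.pathRot_mem hrot p⟩
    refine ⟨Q + Polynomial.X ^ (N - pathWeight F.weight p) * P g e c, ?_, ?_⟩
    · have h1 := hP g e c
      have h2 : (g : EuclideanSpace ℝ (Fin n) ≃ₗᵢ[ℝ] EuclideanSpace ℝ (Fin n)) (F.trans e) =
        (h : EuclideanSpace ℝ (Fin n) ≃ₗᵢ[ℝ] EuclideanSpace ℝ (Fin n))
          (F.pathRot p (F.trans e)) := rfl
      rw [h2] at h1
      simp only [pathTrans, map_add, map_smul, PiLp.add_apply, PiLp.smul_apply, smul_eq_mul,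
        mul_add, h1, hQ, map_mul, map_pow, Polynomial.aeval_X]
      rw [show F.β ^ N = F.β ^ (N - pathWeight F.weight p) * F.β ^ pathWeight F.weight p by
        rw [← pow_add, Nat.sub_add_cancel (by omega)]]
      have h0 := (F.β_pow_pos (pathWeight F.weight p)).ne'
      field_simp
    · intro γ C hγ hC hC0
      have h1 := hQ' γ C hγ hC hC0
      have h2 := hC g e c
      have h3 : 0 < 1 - ‖γ‖ := sub_pos.2 hγ
      simp only [map_add, map_mul, map_pow, Polynomial.aeval_X]
      set m := N - pathWeight F.weight p with hm
      rw [show N + 1 - pathWeight F.weight p = m + 1 by omega] at h1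
      -- One step of a geometric series. The last inequality uses $m\ge N+1-k$, as the prefix has
      -- weight less than $k$.
      calc _ ≤ _ := norm_add_le _ _
        _ ≤ C / (1 - ‖γ‖) * ‖γ‖ ^ (m + 1) + ‖γ‖ ^ m * C := by
            rw [norm_mul, norm_pow]
            gcongr
        _ = C / (1 - ‖γ‖) * ‖γ‖ ^ m := by field_simp; ring
        _ ≤ _ := by
            refine mul_le_mul_of_nonneg_left (pow_le_pow_of_le_one (norm_nonneg _) hγ.le ?_)
              (by positivity)
            omega

/-- There are only finitely many bounded relative translations between paths of the same cut. -/
theorem finite_relTrans [Finite V] [∀ i j : V, Finite (i ⟶ j)] (hβ : IsPisot F.β) (hfin : Finite H)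
    (r : Fin n → ℝ)
    (hb : ∀ h ∈ H, ∀ {i j : V} (e : i ⟶ j), ∀ c : Fin n,
      ∃ z ∈ Algebra.adjoin ℤ ({F.β} : Set ℝ), h (F.trans e) c = r c * z) (B : ℝ) :
    ∃ T : Set (EuclideanSpace ℝ (Fin n)), T.Finite ∧ ∀ (k : ℕ) (i j l : V) (p : Quiver.Path i j)
      (q : Quiver.Path i l), IsCut F.weight k p → IsCut F.weight k q → ‖F.relTrans p q‖ ≤ B →
        F.relTrans p q ∈ T := by
  have hex : ∀ (h : H) (i j : V) (e : i ⟶ j) (c : Fin n), ∃ P : Polynomial ℤ,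
      (h : EuclideanSpace ℝ (Fin n) ≃ₗᵢ[ℝ] EuclideanSpace ℝ (Fin n)) (F.trans e) c =
        r c * Polynomial.aeval F.β P := by
    intro h i j e c
    obtain ⟨z, hz, h1⟩ := hb h h.2 e c
    rw [Algebra.adjoin_singleton_eq_range_aeval] at hz
    obtain ⟨P, rfl⟩ := hz
    exact ⟨P, h1⟩
  choose P hP using hex
  have hbound : ∀ γ : ℂ, ∃ C : ℝ, 0 ≤ C ∧ ∀ (h : H) {i j : V} (e : i ⟶ j) (c : Fin n),
      ‖Polynomial.aeval γ (P h i j e c)‖ ≤ C := by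
    intro γ
    obtain ⟨C, hC⟩ := (Set.finite_range fun a : H × (Σ i j : V, i ⟶ j) × Fin n =>
      ‖Polynomial.aeval γ (P a.1 _ _ a.2.1.2.2 a.2.2)‖).bddAbove
    exact ⟨max 0 C, le_max_left _ _, fun h i j e c =>
      (hC ⟨(h, ⟨i, j, e⟩, c), rfl⟩).trans (le_max_right _ _)⟩
  choose C hC0 hC using hbound
  -- One summand for each of the two translations being subtracted.
  let D : ℂ → ℝ := fun γ => C γ / (1 - ‖γ‖) + C γ / (1 - ‖γ‖)
  let S : Fin n → Set ℝ := fun c => insert 0 ((fun z => r c * z) ''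
    {z : ℝ | |z| ≤ |r c|⁻¹ * B ∧ ∃ P : Polynomial ℤ, Polynomial.aeval F.β P = z ∧
      ∀ γ : ℂ, Polynomial.aeval γ (minpoly ℚ F.β) = 0 → γ ≠ F.β →
        ‖Polynomial.aeval γ P‖ ≤ D γ})
  have hS : (Set.univ.pi S).Finite :=
    Set.Finite.pi fun c => ((hβ.finite_polynomial_values _ D).image _).insert 0
  refine ⟨_, hS.preimage (f := (WithLp.ofLp : EuclideanSpace ℝ (Fin n) → Fin n → ℝ))
    (WithLp.ofLp_injective 2).injOn, fun k i j l p q hp hq hB c _ => ?_⟩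
  by_cases hr : F.relTrans p q c = 0
  · exact Or.inl hr
  refine Or.inr ?_
  -- Since $N\ge k$ exceeds the weight of every proper prefix of `p` and of `q`, multiplying by
  -- $\beta^N$ clears the denominators of both translations.
  set N := pathWeight F.weight p with hNdef
  let h : H := ⟨F.pathRot p, F.pathRot_mem hrot p⟩⁻¹
  have key : ∀ {l : V} {q : Quiver.Path i l}, IsCut F.weight k q → ∃ Q : Polynomial ℤ, F.β ^ N *
      (h : EuclideanSpace ℝ (Fin n) ≃ₗᵢ[ℝ] EuclideanSpace ℝ (Fin n)) (F.pathTrans q) c =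
      r c * Polynomial.aeval F.β Q ∧
      ∀ γ : ℂ, ‖γ‖ < 1 → ‖Polynomial.aeval γ Q‖ ≤ C γ / (1 - ‖γ‖) := by
    intro l q hq
    have := hp.le_pathWeight
    obtain ⟨Q, h1, h2⟩ := F.exists_polynomial_pathTrans hrot r (fun h {i j} e c => P h i j e c)
      (fun h i j e c => hP h i j e c) h c q N hq (by omega)
    refine ⟨Q, h1, fun γ hγ => ?_⟩
    have h3 : 0 < 1 - ‖γ‖ := sub_pos.2 hγ
    exact (h2 γ (C γ) hγ (hC γ) (hC0 γ)).trans (mul_le_of_le_one_right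
      (div_nonneg (hC0 γ) h3.le) (pow_le_one₀ (norm_nonneg _) hγ.le))
  obtain ⟨Q₁, hQ₁, hQ₁'⟩ := key hq
  obtain ⟨Q₂, hQ₂, hQ₂'⟩ := key hp
  have hval : F.relTrans p q c = r c * Polynomial.aeval F.β (Q₁ - Q₂) := by
    rw [map_sub, mul_sub, ← hQ₁, ← hQ₂, ← mul_sub]
    simp only [relTrans, map_sub, PiLp.smul_apply, PiLp.sub_apply, smul_eq_mul]
    rfl
  have hrc : r c ≠ 0 := fun h0 => hr (by rw [hval, h0, zero_mul])
  refine ⟨_, ⟨?_, Q₁ - Q₂, rfl, fun γ hγ hne => ?_⟩, hval.symm⟩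
  · have h1 : |F.relTrans p q c| ≤ B := (PiLp.norm_apply_le (F.relTrans p q) c).trans hB
    rw [hval, abs_mul] at h1
    rwa [← div_eq_inv_mul, le_div_iff₀' (abs_pos.2 hrc)]
  · have hγ1 := hβ.2.2 γ hγ hne
    rw [map_sub]
    exact (norm_sub_le _ _).trans (add_le_add (hQ₁' γ hγ1) (hQ₂' γ hγ1))

end Finiteness

end

end EuclideanModel

end GIFS

/-! ### Vertices given by paths, and correspondence of paths. -/

namespace GIFS

variable {V : Type*} [Quiver V] {X : Type*} [MetricSpace X]

theorem continuous_map (G : GIFS V X) {i j : V} (e : i ⟶ j) : Continuous (G.map e) := by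
  obtain ⟨ρ, h0, -, h⟩ := G.similitude e
  exact (LipschitzWith.of_dist_le_mul (K := ⟨ρ, h0.le⟩) fun x y => (h x y).le).continuous

theorem continuous_pathMap (G : GIFS V X) {i j : V} (p : Quiver.Path i j) :
    Continuous (G.pathMap p) := by
  induction p with
  | nil => exact continuous_id
  | cons p e ih => exact ih.comp (G.continuous_map e)

theorem pathMap_comp (G : GIFS V X) {i j l : V} (p : Quiver.Path i j) (q : Quiver.Path j l) :
    G.pathMap (p.comp q) = G.pathMap p ∘ G.pathMap q := by
  induction q with
  | nil => rfl
  | cons q e ih => simp only [Quiver.Path.comp_cons, pathMap, ih, Function.comp_assoc]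

/-- The vertex of level `k` given by a path. -/
def pathVertex (G : GIFS V X) (k : ℕ) {i j : V} (p : Quiver.Path i j) : G.Vertex :=
  ⟨i, j, k, G.pathMap p⟩

theorem exists_eq_pathVertex {G : GIFS V X} {𝓜 : ℕ → ∀ i j : V, Set (Quiver.Path i j)}
    {v : G.Vertex} (hv : v ∈ G.vertexSet 𝓜) :
    ∃ p ∈ 𝓜 v.level v.src v.tgt, v = G.pathVertex v.level p := by
  obtain ⟨p, hp, h⟩ := hv
  exact ⟨p, hp, by rw [pathVertex, ← h]⟩

namespace EuclideanModel

variable {G : GIFS V X} {U : V → Set X} {n : ℕ} (F : G.EuclideanModel U n)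

/-- The index sets of the model. -/
abbrev cuts (k : ℕ) (i j : V) : Set (Quiver.Path i j) := {p | IsCut F.weight k p}

theorem mem_neighbourhood_pathVertex {i j : V} {k : ℕ} {v : Quiver.Path i j} {u : G.Vertex} :
    u ∈ G.neighbourhood U F.cuts (G.pathVertex k v) ↔
      ∃ (l : V) (p : Quiver.Path i l), IsCut F.weight k p ∧ u = G.pathVertex k p ∧
        Overlap G U v p := by
  constructor
  · rintro ⟨hu, hk, hi, y, ⟨x, hx, rfl⟩, x', hx', hxx'⟩
    obtain ⟨p, hp, h⟩ := exists_eq_pathVertex hu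
    obtain ⟨i', l, k', f⟩ := u
    obtain rfl : i' = i := hi
    obtain rfl : k' = k := hk
    refine ⟨l, p, hp, h, x, hx, x', hx', Subtype.ext ?_⟩
    rw [show f = G.pathMap p by simpa [pathVertex] using h] at hxx'
    exact hxx'.symm
  · rintro ⟨l, p, hp, rfl, x, hx, y, hy, hxy⟩
    exact ⟨⟨p, hp, rfl⟩, rfl, rfl, _, ⟨x, hx, rfl⟩, y, hy, congrArg Subtype.val hxy.symm⟩

/-- The paths `p` and `p'` have the same position relative to `v` and `v'`, respectively, and the
same weight relative to the levels `k` and `k'`. -/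
structure Corresponds (k k' : ℕ) {i i' j l : V} (v : Quiver.Path i j) (v' : Quiver.Path i' j)
    (p : Quiver.Path i l) (p' : Quiver.Path i' l) : Prop where
  weight : pathWeight F.weight p + k' = pathWeight F.weight p' + k
  rot : (F.pathRot v)⁻¹ * F.pathRot p = (F.pathRot v')⁻¹ * F.pathRot p'
  trans : F.relTrans v p = F.relTrans v' p'

/-- The position of the nearby paths of the same cut relative to a path. -/
def typeData (B : ℝ) (k : ℕ) {i j : V} (v : Quiver.Path i j) :
    Set (V × ℕ × (EuclideanSpace ℝ (Fin n) ≃ₗᵢ[ℝ] EuclideanSpace ℝ (Fin n)) ×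
      EuclideanSpace ℝ (Fin n)) :=
  {d | ∃ (l : V) (p : Quiver.Path i l), IsCut F.weight k p ∧ ‖F.relTrans v p‖ ≤ B ∧
    d = (l, pathWeight F.weight p - k, (F.pathRot v)⁻¹ * F.pathRot p, F.relTrans v p)}

theorem exists_corresponds {B : ℝ} {k k' : ℕ} {i i' j l : V} {v : Quiver.Path i j}
    {v' : Quiver.Path i' j} (h : F.typeData B k v = F.typeData B k' v') {p : Quiver.Path i l}
    (hp : IsCut F.weight k p) (hB : ‖F.relTrans v p‖ ≤ B) :
    ∃ p' : Quiver.Path i' l, IsCut F.weight k' p' ∧ F.Corresponds k k' v v' p p' := by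
  have hmem : (l, pathWeight F.weight p - k, (F.pathRot v)⁻¹ * F.pathRot p, F.relTrans v p) ∈
      F.typeData B k v := ⟨l, p, hp, hB, rfl⟩
  rw [h] at hmem
  obtain ⟨l', p', hp', -, heq⟩ := hmem
  simp only [Prod.mk.injEq] at heq
  obtain ⟨rfl, h1, h2, h3⟩ := heq
  have := hp.le_pathWeight
  have := hp'.le_pathWeight
  exact ⟨p', hp', by omega, h2, h3⟩

variable {F} {k k' : ℕ} {i i' j : V} {v : Quiver.Path i j} {v' : Quiver.Path i' j}

theorem Corresponds.symm {l : V} {p : Quiver.Path i l} {p' : Quiver.Path i' l}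
    (h : F.Corresponds k k' v v' p p') : F.Corresponds k' k v' v p' p :=
  ⟨h.weight.symm, h.rot.symm, h.trans.symm⟩

/-- Weights are matched relative to the levels, so the differences $w(v)-w(p)$ and $w(v')-w(p')$
agree, and with them the ratios. -/
theorem Corresponds.relMap_eq (hv : pathWeight F.weight v + k' = pathWeight F.weight v' + k)
    {l : V} {p : Quiver.Path i l} {p' : Quiver.Path i' l} (h : F.Corresponds k k' v v' p p') :
    F.relMap v p = F.relMap v' p' := by
  funext x
  have h1 := h.weight
  have h2 : pathWeight F.weight v + pathWeight F.weight p' =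
    pathWeight F.weight v' + pathWeight F.weight p := by omega
  have h3 : F.β ^ pathWeight F.weight v * (F.β ^ pathWeight F.weight p)⁻¹ =
      F.β ^ pathWeight F.weight v' * (F.β ^ pathWeight F.weight p')⁻¹ := by
    rw [← div_eq_mul_inv, ← div_eq_mul_inv, div_eq_div_iff (F.β_pow_pos _).ne'
      (F.β_pow_pos _).ne', ← pow_add, ← pow_add, h2]
  rw [relMap, relMap, h3, h.rot, h.trans]

theorem Corresponds.self (hv : pathWeight F.weight v + k' = pathWeight F.weight v' + k) :
    F.Corresponds k k' v v' v v' :=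
  ⟨hv, by simp, by rw [relTrans_self, relTrans_self]⟩

/-! ### The similitude induced by correspondence. -/

section Dist

variable (hU : G.IsInvariantOpenFamily U) (hUW : ∀ i, closure (U i) = G.W i)
  (hv : pathWeight F.weight v + k' = pathWeight F.weight v' + k)
include hU hUW hv

/-- Distances between corresponding paths are proportional. -/
theorem Corresponds.dist_eq {l s : V} {p : Quiver.Path i l} {p' : Quiver.Path i' l}
    {q : Quiver.Path i s} {q' : Quiver.Path i' s} (hp : F.Corresponds k k' v v' p p')
    (hq : F.Corresponds k k' v v' q q') (x : G.W l) (y : G.W s) :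
    F.β ^ pathWeight F.weight v' * dist (G.pathMap p' x) (G.pathMap q' y) =
      F.β ^ pathWeight F.weight v * dist (G.pathMap p x) (G.pathMap q y) := by
  -- Charts control only points of `U`; density and continuity carry the identity over to `W`.
  have dense : ∀ l : V, Dense {x : G.W l | (x : X) ∈ U l} := by
    intro l
    rw [Subtype.dense_iff]
    intro x hx
    rw [← hUW l] at hx
    refine closure_mono ?_ hx
    intro y hy
    exact ⟨⟨y, hU.subset l hy⟩, hy, rfl⟩
  have hd := (dense l).prod (dense s)
  have c := fun {a b : V} (p : Quiver.Path a b) => G.continuous_pathMap p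
  refine congrFun (Continuous.ext_on hd
    (f := fun z : G.W l × G.W s => F.β ^ pathWeight F.weight v' *
      dist (G.pathMap p' z.1) (G.pathMap q' z.2))
    (g := fun z : G.W l × G.W s => F.β ^ pathWeight F.weight v *
      dist (G.pathMap p z.1) (G.pathMap q z.2)) ?_ ?_ ?_) (x, y)
  · exact continuous_const.mul (((c p').comp continuous_fst).dist ((c q').comp continuous_snd))
  · exact continuous_const.mul (((c p).comp continuous_fst).dist ((c q).comp continuous_snd))
  · rintro ⟨x, y⟩ ⟨hx, hy⟩
    simp only
    rw [F.dist_pathMap_eq hU v' p' q' x hx y hy, F.dist_pathMap_eq hU v p q x hx y hy,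
      hp.relMap_eq hv, hq.relMap_eq hv]

/-- Proportional distances vanish together, so coincidences of points are transported. -/
theorem Corresponds.eq_of_eq {l s : V} {p : Quiver.Path i l} {p' : Quiver.Path i' l}
    {q : Quiver.Path i s} {q' : Quiver.Path i' s} (hp : F.Corresponds k k' v v' p p')
    (hq : F.Corresponds k k' v v' q q') {x : G.W l} {y : G.W s}
    (h : G.pathMap p x = G.pathMap q y) : G.pathMap p' x = G.pathMap q' y := by
  have h1 := hp.dist_eq hU hUW hv hq x y
  rw [h, dist_self, mul_zero] at h1
  exact dist_eq_zero.1 ((mul_eq_zero.1 h1).resolve_left (F.β_pow_pos _).ne')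

theorem Corresponds.overlap {l s : V} {p : Quiver.Path i l} {p' : Quiver.Path i' l}
    {q : Quiver.Path i s} {q' : Quiver.Path i' s} (hp : F.Corresponds k k' v v' p p')
    (hq : F.Corresponds k k' v v' q q') (h : Overlap G U p q) : Overlap G U p' q' := by
  obtain ⟨x, hx, y, hy, hxy⟩ := h
  exact ⟨x, hx, y, hy, hp.eq_of_eq hU hUW hv hq hxy⟩

/-- The vertices are given by corresponding paths. -/
def VertexCorresponds (F : G.EuclideanModel U n) (k k' : ℕ) {i i' j : V} (v : Quiver.Path i j)
    (v' : Quiver.Path i' j) (u u' : G.Vertex) : Prop :=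
  ∃ (l : V) (p : Quiver.Path i l) (p' : Quiver.Path i' l), u = G.pathVertex k p ∧
    u' = G.pathVertex k' p' ∧ F.Corresponds k k' v v' p p'

omit hU hUW hv in
theorem VertexCorresponds.symm {u u' : G.Vertex} (h : F.VertexCorresponds k k' v v' u u') :
    F.VertexCorresponds k' k v' v u' u := by
  obtain ⟨l, p, p', h1, h2, h⟩ := h
  exact ⟨l, p', p, h2, h1, h.symm⟩

/-- Several paths may define one vertex. The correspondence of vertices is nevertheless
single-valued, which makes it a bijection of neighbourhoods. -/
theorem VertexCorresponds.unique {u u₁ u₂ : G.Vertex} (h₁ : F.VertexCorresponds k k' v v' u u₁)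
    (h₂ : F.VertexCorresponds k k' v v' u u₂) : u₁ = u₂ := by
  obtain ⟨l, p, p', rfl, rfl, hp⟩ := h₁
  obtain ⟨s, q, q', hpq, rfl, hq⟩ := h₂
  obtain rfl : l = s := congrArg Vertex.tgt hpq
  have h1 : G.pathMap p = G.pathMap q := by simpa [pathVertex] using hpq
  have h2 : G.pathMap p' = G.pathMap q' :=
    funext fun z => hp.eq_of_eq hU hUW hv hq (congrFun h1 z)
  simp only [pathVertex, h2]

/-- There is a similitude mapping paths to corresponding ones. -/
theorem exists_similitude : ∃ τ : X → X,
    (∀ u u' : G.Vertex, F.VertexCorresponds k k' v v' u u' → Matches τ u u') ∧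
    ∀ s : Set X, (∀ z ∈ s, ∃ u u' : G.Vertex, F.VertexCorresponds k k' v v' u u' ∧ z ∈ u.range) →
      IsSimilitudeOn τ s := by
  classical
  -- `P` is the graph of `τ`; proportionality of distances makes it single-valued. The value of `τ`
  -- off its domain is immaterial.
  let P : X → X → Prop := fun z z' => ∃ (l : V) (p : Quiver.Path i l) (p' : Quiver.Path i' l)
    (x : G.W l), F.Corresponds k k' v v' p p' ∧ (G.pathMap p x : X) = z ∧
      (G.pathMap p' x : X) = z'
  let τ : X → X := fun z => if h : ∃ z', P z z' then h.choose else z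
  have hP : ∀ {z₁ z₁' z₂ z₂' : X}, P z₁ z₁' → P z₂ z₂' →
      F.β ^ pathWeight F.weight v' * dist z₁' z₂' = F.β ^ pathWeight F.weight v * dist z₁ z₂ := by
    rintro _ _ _ _ ⟨l₁, p₁, p₁', x₁, h₁, rfl, rfl⟩ ⟨l₂, p₂, p₂', x₂, h₂, rfl, rfl⟩
    exact h₁.dist_eq hU hUW hv h₂ x₁ x₂
  have hτ : ∀ {z z' : X}, P z z' → τ z = z' := by
    intro z z' h
    have h1 : ∃ z', P z z' := ⟨z', h⟩
    have h2 := hP h1.choose_spec h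
    rw [dist_self, mul_zero] at h2
    simp only [τ, dif_pos h1]
    exact dist_eq_zero.1 ((mul_eq_zero.1 h2).resolve_left (F.β_pow_pos _).ne')
  refine ⟨τ, ?_, fun s hs => ⟨(F.β ^ pathWeight F.weight v')⁻¹ * F.β ^ pathWeight F.weight v,
      mul_pos (inv_pos.2 (F.β_pow_pos _)) (F.β_pow_pos _), ?_⟩⟩
  · rintro _ _ ⟨l, p, p', rfl, rfl, h⟩
    exact ⟨rfl, fun x hx _ => (hτ ⟨l, p, p', ⟨x, hx⟩, h, rfl, rfl⟩).symm⟩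
  · have hran : ∀ z ∈ s, P z (τ z) := by
      intro z hz
      obtain ⟨_, _, ⟨l, p, p', rfl, rfl, h⟩, x, rfl⟩ := hs z hz
      have h1 : P (G.pathMap p x) (G.pathMap p' x) := ⟨l, p, p', x, h, rfl, rfl⟩
      exact (hτ h1).symm ▸ h1
    intro x hx y hy
    rw [mul_assoc, ← hP (hran x hx) (hran y hy), inv_mul_cancel_left₀ (F.β_pow_pos _).ne']

end Dist

theorem overlap_self (hU : G.IsInvariantOpenFamily U) {i j : V} (p : Quiver.Path i j) :
    Overlap G U p p := by
  obtain ⟨x, hx⟩ := hU.nonempty j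
  exact ⟨⟨x, hU.subset j hx⟩, hx, ⟨x, hU.subset j hx⟩, hx, rfl⟩

/-! ### Equal configurations give equivalent vertices. -/

section Equiv

variable (hU : G.IsInvariantOpenFamily U) (hUW : ∀ i, closure (U i) = G.W i)
  {ρ : ℝ} (hρ : ∀ i, ∀ x ∈ U i, ‖F.chart i x‖ ≤ ρ) {K : ℕ}
  (hK : ∀ {i j : V} (e : i ⟶ j), F.weight i j e ≤ K)
  (hw : pathWeight F.weight v + k' = pathWeight F.weight v' + k)
  (hv : IsCut F.weight k v) (hv' : IsCut F.weight k' v')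
  (hdata : F.typeData (4 * ρ * F.β ^ K) k v = F.typeData (4 * ρ * F.β ^ K) k' v')
include hU hUW hρ hK hw hv hdata

/-- A vertex records only a map, so the path `d` that makes $f_p\circ f_e$ a vertex need not extend
`p`. Its prefix `d₁` of level `k` overlaps `p` but perhaps not `v`; being a neighbour of a
neighbour, it is still seen by `typeData`. Its counterpart, extended by the same edges, then serves
for `p'`. -/
theorem Corresponds.descendants_subset {l : V} {p : Quiver.Path i l} {p' : Quiver.Path i' l}
    (hp : IsCut F.weight k p) (h : F.Corresponds k k' v v' p p')
    (hov : Overlap G U v p) (q : ℕ) :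
    G.descendants F.cuts (G.pathVertex k p) q ⊆ G.descendants F.cuts (G.pathVertex k' p') q := by
  rintro a ⟨t, e, he, ⟨d, hd, hmap⟩, rfl⟩
  refine ⟨t, e, he, ?_, rfl⟩
  change IsCut F.weight (k + q) d at hd
  change G.pathMap p ∘ G.pathMap e = G.pathMap d at hmap
  obtain ⟨s, d₁, r, hd₁, rfl⟩ := exists_isCut_prefix d ((Nat.le_add_right k q).trans
    hd.le_pathWeight)
  rw [pathMap_comp] at hmap
  have hov₁ : Overlap G U p d₁ := by
    obtain ⟨x, hx⟩ := hU.nonempty t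
    exact ⟨G.pathMap e ⟨x, hU.subset t hx⟩, pathMap_mem hU e _ hx,
      G.pathMap r ⟨x, hU.subset t hx⟩, pathMap_mem hU r _ hx, congrFun hmap _⟩
  obtain ⟨d₁', hd₁', hc⟩ := F.exists_corresponds hdata hd₁
    (F.norm_relTrans_le hU hρ hK hv hp hd₁ hov hov₁)
  refine ⟨d₁'.comp r, hd₁'.comp_of_pathWeight_eq hc.weight hd, ?_⟩
  change G.pathMap p' ∘ G.pathMap e = G.pathMap (d₁'.comp r)
  rw [pathMap_comp]
  funext x
  exact h.eq_of_eq hU hUW hw hc (congrFun hmap x)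

include hv'

/-- Each neighbour of `v` corresponds to one of `v'`. -/
theorem exists_neighbour {u : G.Vertex} (hu : u ∈ G.neighbourhood U F.cuts (G.pathVertex k v)) :
    ∃ u' ∈ G.neighbourhood U F.cuts (G.pathVertex k' v'), F.VertexCorresponds k k' v v' u u' ∧
      ∀ q, G.descendants F.cuts u q = G.descendants F.cuts u' q := by
  obtain ⟨l, p, hp, rfl, hov⟩ := F.mem_neighbourhood_pathVertex.1 hu
  obtain ⟨p', hp', hc⟩ := F.exists_corresponds hdata hp
    (F.norm_relTrans_le hU hρ hK hv hv hp (overlap_self hU v) hov)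
  have hov' := (Corresponds.self hw).overlap hU hUW hw hc hov
  exact ⟨_, F.mem_neighbourhood_pathVertex.2 ⟨l, p', hp', rfl, hov'⟩, ⟨l, p, p', rfl, rfl, hc⟩,
    fun q => (hc.descendants_subset hU hUW hρ hK hw hv hdata hp hov q).antisymm
      (hc.symm.descendants_subset hU hUW hρ hK hw.symm hv' hdata.symm hp' hov' q)⟩

/-- Paths with the same data give equivalent vertices. -/
theorem vertexEquiv_pathVertex :
    G.VertexEquiv U F.cuts (G.pathVertex k v) (G.pathVertex k' v') := by
  have hex := fun u : G.neighbourhood U F.cuts (G.pathVertex k v) =>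
    exists_neighbour hU hUW hρ hK hw hv hv' hdata u.2
  choose g hmem hcorr hdesc using hex
  have hex' := fun u : G.neighbourhood U F.cuts (G.pathVertex k' v') =>
    exists_neighbour hU hUW hρ hK hw.symm hv' hv hdata.symm u.2
  choose g' hmem' hcorr' hdesc' using hex'
  obtain ⟨τ, hτ, hsim⟩ := exists_similitude hU hUW hw
  refine ⟨τ, hsim _ fun z hz => ?_, hτ _ _ ⟨j, v, v', rfl, rfl, Corresponds.self hw⟩,
    ⟨fun u => ⟨g u, hmem u⟩, fun u => ⟨g' u, hmem' u⟩, fun u => Subtype.ext ?_,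
      fun u => Subtype.ext ?_⟩, fun u => hτ _ _ (hcorr u), fun u q _ => hdesc u q⟩
  · simp only [Set.mem_iUnion] at hz
    obtain ⟨u, hu, hz⟩ := hz
    exact ⟨u, _, hcorr ⟨u, hu⟩, hz⟩
  · exact (hcorr' ⟨g u, hmem u⟩).unique hU hUW hw.symm (hcorr u).symm
  · exact (hcorr ⟨g' u, hmem' u⟩).unique hU hUW hw (hcorr' u).symm

end Equiv

/-! ### Counting the neighbourhood types. -/

/-- A GIFS modelled on Euclidean similitudes with a Pisot ratio and translations in a lattice over
`ℤ[β]` is of finite type. -/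
theorem isFiniteTypeFamily [Finite V] [Nonempty V] [∀ i j : V, Finite (i ⟶ j)]
    (F : G.EuclideanModel U n) (hV : ∀ i : V, ∃ j : V, Nonempty (i ⟶ j))
    (hU : G.IsInvariantOpenFamily U) (hUW : ∀ i, closure (U i) = G.W i) (hβ : IsPisot F.β)
    {H : Subgroup (EuclideanSpace ℝ (Fin n) ≃ₗᵢ[ℝ] EuclideanSpace ℝ (Fin n))} (hfin : Finite H)
    (hrot : ∀ {i j : V} (e : i ⟶ j), F.rot e ∈ H) (r : Fin n → ℝ)
    (hb : ∀ h ∈ H, ∀ {i j : V} (e : i ⟶ j), ∀ c : Fin n,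
      ∃ z ∈ Algebra.adjoin ℤ ({F.β} : Set ℝ), h (F.trans e) c = r c * z) :
    G.IsFiniteTypeFamily U := by
  obtain ⟨K, hK⟩ : ∃ K : ℕ, ∀ {i j : V} (e : i ⟶ j), F.weight i j e ≤ K := by
    obtain ⟨K, hK⟩ := (Set.finite_range fun a : Σ i j : V, i ⟶ j =>
      F.weight _ _ a.2.2).bddAbove
    exact ⟨K, fun {i j} e => hK ⟨⟨i, j, e⟩, rfl⟩⟩
  obtain ⟨ρ, hρ⟩ : ∃ ρ : ℝ, ∀ i, ∀ x ∈ U i, ‖F.chart i x‖ ≤ ρ := by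
    have h1 : ∀ i, ∃ ρ : ℝ, ∀ x ∈ U i, ‖F.chart i x‖ ≤ ρ := by
      intro i
      obtain ⟨y, hy⟩ := hU.nonempty i
      obtain ⟨C, hC⟩ := Metric.isBounded_iff.1 (hU.bounded i)
      refine ⟨C + ‖F.chart i y‖, fun x hx => ?_⟩
      have h2 := (F.isometry i).dist_eq ⟨x, hx⟩ ⟨y, hy⟩
      simp only [Set.domRestrict_apply, Subtype.dist_eq] at h2
      have h3 := hC hx hy
      rw [← h2, dist_eq_norm] at h3
      have h4 := norm_le_norm_add_norm_sub' (F.chart i x) (F.chart i y)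
      linarith
    choose ρ h1 using h1
    obtain ⟨C, hC⟩ := (Set.finite_range ρ).bddAbove
    exact ⟨C, fun i x hx => (h1 i x hx).trans (hC ⟨i, rfl⟩)⟩
  obtain ⟨T, hT, hmem⟩ := F.finite_relTrans hrot hβ hfin r hb (4 * ρ * F.β ^ K)
  refine ⟨hU, F.cuts, isNestedIndexSets_isCut hV F.weight_pos hK, ?_⟩
  choose path hpath hvertex using fun v : G.vertexSet F.cuts => exists_eq_pathVertex v.2
  -- The choice of a path for each vertex is harmless: any two paths with equal data give equivalent
  -- vertices. The subtraction is exact, as weights in a cut are at least its level.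
  let data := fun v : G.vertexSet F.cuts =>
    ((v : G.Vertex).tgt, pathWeight F.weight (path v) - (v : G.Vertex).level,
      F.typeData (4 * ρ * F.β ^ K) (v : G.Vertex).level (path v))
  let S : Set (V × ℕ × (EuclideanSpace ℝ (Fin n) ≃ₗᵢ[ℝ] EuclideanSpace ℝ (Fin n)) ×
    EuclideanSpace ℝ (Fin n)) := Set.univ ×ˢ Set.Iic K ×ˢ (H : Set _) ×ˢ T
  have hS : S.Finite :=
    Set.finite_univ.prod ((Set.finite_Iic K).prod ((Set.finite_coe_iff (s := SetLike.coe H)).1 hfin |>.prod hT))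
  have hweight : ∀ {k : ℕ} {i j : V} {p : Quiver.Path i j}, IsCut F.weight k p →
      pathWeight F.weight p - k ≤ K := by
    intro k i j p hp
    have := hp.pathWeight_le hK
    omega
  have hrange : (Set.range data).Finite := by
    -- Each configuration is a subset of the finite set `S`, so only finitely many occur.
    refine (Set.finite_univ.prod ((Set.finite_Iic K).prod hS.finite_subsets)).subset ?_
    rintro _ ⟨v, rfl⟩
    refine ⟨trivial, hweight (hpath v), ?_⟩
    rintro _ ⟨l, p, hp, hB, rfl⟩
    exact ⟨trivial, hweight hp, H.mul_mem (H.inv_mem (F.pathRot_mem hrot _))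
      (F.pathRot_mem hrot _), hmem _ _ _ _ _ _ (hpath v) hp hB⟩
  have hequiv : ∀ v v' : G.vertexSet F.cuts, data v = data v' →
      G.VertexEquiv U F.cuts (v : G.Vertex) (v' : G.Vertex) := by
    have key : ∀ {i i' j j' : V} {k k' : ℕ} {p : Quiver.Path i j} {p' : Quiver.Path i' j'},
        IsCut F.weight k p → IsCut F.weight k' p' → j = j' →
        pathWeight F.weight p - k = pathWeight F.weight p' - k' →
        F.typeData (4 * ρ * F.β ^ K) k p = F.typeData (4 * ρ * F.β ^ K) k' p' →
        G.VertexEquiv U F.cuts (G.pathVertex k p) (G.pathVertex k' p') := by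
      rintro i i' j _ k k' p p' hp hp' rfl hw hdata
      have := hp.le_pathWeight
      have := hp'.le_pathWeight
      exact vertexEquiv_pathVertex hU hUW hρ hK (by omega) hp hp' hdata
    intro v v' h
    simp only [data, Prod.mk.injEq] at h
    have := key (hpath v) (hpath v') h.1 h.2.1 h.2.2
    rwa [← hvertex, ← hvertex] at this
  have := hrange.to_subtype
  refine Finite.of_injective
    (fun q : Quotient (vertexSetoid hU F.cuts) => (⟨data q.out, q.out, rfl⟩ : Set.range data))
    fun q q' h => ?_
  rw [← Quotient.out_equiv_out]
  exact hequiv _ _ (congrArg Subtype.val h)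

end EuclideanModel

end GIFS

theorem theorem5p1
    {n : ℕ} {M : Type*} [MetricSpace M] [CompleteSpace M]
    [ChartedSpace (EuclideanSpace ℝ (Fin n)) M] [IsManifold (𝓡 n) ∞ M]
    [Bundle.RiemannianBundle (fun x : M => TangentSpace (𝓡 n) x)]
    [IsContMDiffRiemannianBundle (𝓡 n) ∞ (EuclideanSpace ℝ (Fin n))
      (fun x : M => TangentSpace (𝓡 n) x)]
    [IsRiemannianManifold (𝓡 n) M]
    (hM : IsLocallyEuclidean n M)
    -- the finite directed multigraph, in which every vertex has an outgoing edge
    {V : Type*} [Finite V] [Nonempty V] [Quiver V] [∀ i j : V, Finite (i ⟶ j)]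
    (hV : ∀ i : V, ∃ j : V, Nonempty (i ⟶ j))
    (G : GIFS V M)
    (hW : ∀ i, IsCompact (G.W i) ∧ (G.W i).Nonempty)
    (U : V → Set M) (hU : G.IsInvariantOpenFamily U) (hUW : ∀ i, closure (U i) = G.W i)
    -- the isometries onto subsets of Euclidean space
    (g : V → M → EuclideanSpace ℝ (Fin n)) (hg : ∀ i, Isometry ((U i).domRestrict (g i)))
    (β : ℝ) (hβ : IsPisot β)
    (κ : ∀ {i j : V}, (i ⟶ j) → ℕ) (hκ : ∀ {i j : V} (e : i ⟶ j), 0 < κ e)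
    (R : ∀ {i j : V}, (i ⟶ j) → (EuclideanSpace ℝ (Fin n) ≃ₗᵢ[ℝ] EuclideanSpace ℝ (Fin n)))
    (b : ∀ {i j : V}, (i ⟶ j) → EuclideanSpace ℝ (Fin n))
    (hconj : ∀ {i j : V} (e : i ⟶ j) (x : G.W j), (x : M) ∈ U j →
      g i (G.map e x) = (β ^ κ e)⁻¹ • R e (g j x) + b e)
    (H : Subgroup (EuclideanSpace ℝ (Fin n) ≃ₗᵢ[ℝ] EuclideanSpace ℝ (Fin n)))
    (hH : H = Subgroup.closure {h | ∃ (i j : V) (e : i ⟶ j), h = R e}) (hfin : Finite H)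
    (r : Fin n → ℝ)
    (hb : ∀ h ∈ H, ∀ {i j : V} (e : i ⟶ j), ∀ c : Fin n,
      ∃ z ∈ Algebra.adjoin ℤ ({β} : Set ℝ), h (b e) c = r c * z) :
    G.IsFiniteType ∧ G.IsFiniteTypeFamily U := by
  let F : G.EuclideanModel U n :=
    { chart := g
      isometry := hg
      β := β
      one_lt := hβ.1
      weight := fun _ _ e => κ e
      weight_pos := fun e => hκ e
      rot := fun e => R e
      trans := fun e => b e
      conj := fun e => hconj e }
  have h : G.IsFiniteTypeFamily U := F.isFiniteTypeFamily hV hU hUW hβ hfin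
    (fun {i j} e => hH ▸ Subgroup.subset_closure ⟨i, j, e, rfl⟩) r hb
  exact ⟨⟨U, h⟩, h⟩
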